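/- For $x\in\{0,1\}^6$ let $$f_{6c}(x)=x_4(1\oplus x_2)x_3\oplus x_5(1\oplus x_3)x_1\oplus x_6(1\oplus x_1)x_2\oplus x_1x_2x_3,$$ $$f_{6q}(x)=f_{6c}(x_1\oplus x_4,\;x_2\oplus x_5,\;x_3\oplus x_6,\;x_4,\;x_5,\;x_6),$$ where $\oplus$ is addition modulo 2. A quantum supermap with $T$ slots is a $T$-linear map $\mathcal S$ that takes linear maps $\mathcal M_k:\mathcal L(\mathcal H^{I_k})\to\mathcal L(\mathcal H^{O_k})$, $1\le k\le T$, to a linear map $\mathcal S(\mathcal M_1,\dots,\mathcal M_T):\mathcal L(\mathcal H^P)\to\mathcal L(\mathcal H^F)$ (all spaces finite-dimensional) and is completely CP-preserving (the extension of $\mathcal S$ by the identity on arbitrary finite-dimensional ancillas at each slot takes completely positive maps to a completely positive map) and TP-preserving (it takes quantum channels to a trace-preserving map). No causal order of the slots is assumed. For $x\in\{0,1\}^n$ let $\widetilde{\mathcal O}_x$ be the unitary channel $\rho\mapsto\widetilde O_x\rho\,\widetilde O_x^\dagger$ on $\mathcal L(\mathbb C^{n+1})$, where $\widetilde O_x|0\rangle=|0\rangle$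 and $\widetilde O_x|i\rangle=(-1)^{x_i}|i\rangle$ for $1\le i\le n$. For $f:\{0,1\}^n\to\{0,1\}$, the generalised exact quantum query complexity $Q_E^{\mathrm{Gen}}(f)$ is the minimum $T$ for which there is a $T$-slot quantum supermap $\mathcal S$, with all slots $\mathcal L(\mathbb C^{n+1})\to\mathcal L(\mathbb C^{n+1})$, with trivial $\mathcal H^P$ and with $\mathcal H^F=\mathbb C^2$, such that for every $x\in\{0,1\}^n$ measuring the qubit state $\mathcal S(\widetilde{\mathcal O}_x,\dots,\widetilde{\mathcal O}_x)$ in the computational basis gives $f(x)$ with probability $1$. Then $$Q_E^{\mathrm{Gen}}(f_{6q})=3.$$ -/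

import Mathlib

open scoped Matrix Kronecker ComplexOrder

noncomputable section

/-- Linear maps `L(H^n) → L(H^m)`, where `H^n = ℂ^n` has the computational basis `n`. -/
abbrev SuperOp (n m : Type) : Type := Matrix n n ℂ →ₗ[ℂ] Matrix m m ℂ

/-- The matrix `(Φ ⊗ id_d)(X)`. -/
def ampliation {n m : Type} (Φ : SuperOp n m) (d : ℕ)
    (X : Matrix (n × Fin d) (n × Fin d) ℂ) : Matrix (m × Fin d) (m × Fin d) ℂ :=
  Matrix.of fun p q => Φ (X.submatrix (fun i => (i, p.2)) (fun i => (i, q.2))) p.1 q.1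

/-- Complete positivity: `Φ ⊗ id_d` preserves positive semidefiniteness for every `d`. -/
def IsCP {n m : Type} (Φ : SuperOp n m) : Prop :=
  ∀ (d : ℕ) (X : Matrix (n × Fin d) (n × Fin d) ℂ),
    X.PosSemidef → (ampliation Φ d X).PosSemidef

/-- Trace preservation. -/
def IsTP {n m : Type} [Fintype n] [Fintype m] (Φ : SuperOp n m) : Prop :=
  ∀ X : Matrix n n ℂ, (Φ X).trace = X.trace

/-- Quantum channels: completely positive trace-preserving maps. -/
def IsChannel {n m : Type} [Fintype n] [Fintype m] (Φ : SuperOp n m) : Prop :=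
  IsCP Φ ∧ IsTP Φ

/-- The component `X ↦ ⟨b| Φ(|a⟩⟨a'| ⊗ X) |b'⟩` of a map `Φ : L(H^a ⊗ H^n) → L(H^b ⊗ H^m)`. -/
def block {α β n m : Type} [DecidableEq α] (Φ : SuperOp (α × n) (β × m))
    (a a' : α) (b b' : β) : SuperOp n m where
  toFun X := (Φ (Matrix.single a a' (1 : ℂ) ⊗ₖ X)).submatrix (fun i => (b, i)) (fun i => (b', i))
  map_add' X Y := by
    rw [Matrix.kronecker_add, map_add]; rfl
  map_smul' c X := by
    rw [Matrix.kronecker_smul, map_smul]; rfl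

/-- The action of `S ⊗ id` on maps `M k : L(H^{A_k} ⊗ H^{I_k}) → L(H^{B_k} ⊗ H^{O_k})`: the
`T`-linear extension of `(N_k ⊗ R_k)_k ↦ (⨂_k N_k) ⊗ S(R_1, …, R_T)`. -/
def extend {T : ℕ} {I O : Fin T → Type} {P F : Type}
    (S : MultilinearMap ℂ (fun k => SuperOp (I k) (O k)) (SuperOp P F))
    {A B : Fin T → ℕ} (M : ∀ k, SuperOp (Fin (A k) × I k) (Fin (B k) × O k)) :
    SuperOp ((∀ k, Fin (A k)) × P) ((∀ k, Fin (B k)) × F) where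
  toFun X := Matrix.of fun p q =>
    ∑ a : (∀ k, Fin (A k)), ∑ a' : (∀ k, Fin (A k)),
      S (fun k => block (M k) (a k) (a' k) (p.1 k) (q.1 k))
        (X.submatrix (fun i => (a, i)) (fun i => (a', i))) p.2 q.2
  map_add' X Y := by
    ext p q
    simp [Matrix.submatrix_add, Finset.sum_add_distrib]
  map_smul' c X := by
    ext p q
    simp [Matrix.submatrix_smul, Finset.mul_sum]

/-- A (general) quantum supermap with `T` slots: a `T`-linear map from `T` superoperators
`L(H^{I_k}) → L(H^{O_k})` to a superoperator `L(H^P) → L(H^F)` that is completely CP-preserving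
and TP-preserving (it maps channels to trace-preserving maps). No causal order of the slots is
required. -/
structure IsQuantumSupermap {T : ℕ} {I O : Fin T → Type} {P F : Type}
    [∀ k, Fintype (I k)] [∀ k, Fintype (O k)] [Fintype P] [Fintype F]
    (S : MultilinearMap ℂ (fun k => SuperOp (I k) (O k)) (SuperOp P F)) : Prop where
  completely_cp_preserving :
    ∀ (A B : Fin T → ℕ) (M : ∀ k, SuperOp (Fin (A k) × I k) (Fin (B k) × O k)),
      (∀ k, IsCP (M k)) → IsCP (extend S M)
  tp_preserving :
    ∀ M : ∀ k, SuperOp (I k) (O k), (∀ k, IsChannel (M k)) → IsTP (S M)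

/-- The phase oracle on `ℂ^{n+1}`: `|0⟩ ↦ |0⟩` and `|i⟩ ↦ (-1)^{x_i} |i⟩` for `1 ≤ i ≤ n`
(the bit `x_i` is `x (i - 1)`, as `x` is indexed from zero). -/
def oracle {n : ℕ} (x : Fin n → Bool) : Matrix (Fin (n + 1)) (Fin (n + 1)) ℂ :=
  Matrix.diagonal (Fin.cons 1 fun i => if x i then -1 else 1)

/-- The map `X ↦ U X U†`. -/
def conjMap {n : Type} [Fintype n] (U : Matrix n n ℂ) : SuperOp n n where
  toFun X := U * X * Uᴴ
  map_add' X Y := by rw [Matrix.mul_add, Matrix.add_mul]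
  map_smul' c X := by simp

/-- `S`, a `T`-slot map with trivial past and a qubit as future, computes `f` exactly: on `T`
copies of the oracle channel its output state `ρ_x` satisfies `⟨f(x)| ρ_x |f(x)⟩ = 1`. -/
def ComputesExactly {n T : ℕ} (f : (Fin n → Bool) → Bool)
    (S : MultilinearMap ℂ (fun _ : Fin T => SuperOp (Fin (n + 1)) (Fin (n + 1)))
      (SuperOp Unit Bool)) : Prop :=
  ∀ x : Fin n → Bool,
    (S (fun _ => conjMap (oracle x)) (1 : Matrix Unit Unit ℂ)) (f x) (f x) = 1

/-- The generalised exact quantum query complexity: the least number `T` of slots of a general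
quantum supermap that computes `f` exactly. -/
def QEGen {n : ℕ} (f : (Fin n → Bool) → Bool) : ℕ :=
  sInf {T : ℕ | ∃ S : MultilinearMap ℂ (fun _ : Fin T => SuperOp (Fin (n + 1)) (Fin (n + 1)))
      (SuperOp Unit Bool), IsQuantumSupermap S ∧ ComputesExactly f S}

end

/-- `x₄(1⊕x₂)x₃ ⊕ x₅(1⊕x₃)x₁ ⊕ x₆(1⊕x₁)x₂ ⊕ x₁x₂x₃`, with `x_i` written `x (i - 1)`. -/
def f6c (x : Fin 6 → Bool) : Bool :=
  (x 3 && !x 1 && x 2) ^^ (x 4 && !x 2 && x 0) ^^ (x 5 && !x 0 && x 1) ^^ (x 0 && x 1 && x 2)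

/-- `f6c (x₁⊕x₄, x₂⊕x₅, x₃⊕x₆, x₄, x₅, x₆)`. -/
def f6q (x : Fin 6 → Bool) : Bool :=
  f6c ![x 0 ^^ x 3, x 1 ^^ x 4, x 2 ^^ x 5, x 3, x 4, x 5]

/-! ### Positive semidefinite matrices -/

/-! Lower bound, by the polynomial method: each entry of an oracle channel carries two phases, so by
multilinearity the output on `T` oracles has Fourier degree at most `2T` in the bits. The full
parity coefficient of `f6q` is nonzero, so `6 ≤ 2T` (`le_two_mul_of_computesExactly`). Causal order
plays no role.

Upper bound: three parties are wired by the Lugano process, and each reads one parity of two phases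
with a single query. At most one party receives the bit 1. A party receiving 0 sends an argument
`x_k ⊕ x_{k+3}` of `f6c`; one receiving 1 sends `x_{k+3}`, the bit which that monomial of `f6c`
selects. The bits sent are the unique fixed point of this loop and determine `f6q x`
(`exists_luganoInput_fixedPoint`). The loop is a supermap: Schur products give complete positivity,
and `sum_luganoInput_eq_one` gives trace preservation. -/

theorem Matrix.PosSemidef.sum_blocks {α β : Type} [Fintype α] [Fintype β]
    {Y : Matrix (α × β) (α × β) ℂ} (hY : Y.PosSemidef) :
    (Matrix.of fun p q : β => ∑ a, ∑ a', Y (a, p) (a', q)).PosSemidef := by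
  classical
  let J : Matrix β (α × β) ℂ := Matrix.of fun p q => (1 : Matrix β β ℂ) p q.2
  convert hY.mul_mul_conjTranspose_same J using 1
  ext p q
  simp only [J, Matrix.mul_apply, Matrix.conjTranspose_apply, Matrix.of_apply, Matrix.one_apply,
    Fintype.sum_prod_type, ite_mul, one_mul, zero_mul, Finset.sum_ite_eq, Finset.mem_univ, if_true,
    apply_ite star, star_one, star_zero, mul_ite, mul_one, mul_zero]
  exact Finset.sum_comm

theorem Matrix.PosSemidef.hadamard_complex {α : Type} {K L : Matrix α α ℂ}
    (hK : K.PosSemidef) (hL : L.PosSemidef) : (K ⊙ L).PosSemidef :=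
  hK.hadamard hL

theorem Matrix.PosSemidef.one_entries (α : Type) [Finite α] :
    (Matrix.of fun _ _ : α => (1 : ℂ)).PosSemidef := by
  convert Matrix.posSemidef_vecMulVec_self_star (fun _ : α => (1 : ℂ)) using 1
  ext p q
  simp [Matrix.vecMulVec_apply]

theorem Matrix.PosSemidef.prod_hadamard {α κ : Type} [Finite α] (s : Finset κ)
    {K : κ → Matrix α α ℂ} (hK : ∀ k, (K k).PosSemidef) :
    (Matrix.of fun p q : α => ∏ k ∈ s, K k p q).PosSemidef := by
  classical
  induction s using Finset.induction_on with
  | empty => simpa using Matrix.PosSemidef.one_entries α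
  | insert k s hk ih =>
    convert (hK k).hadamard_complex ih using 1
    ext p q
    simp [Finset.prod_insert hk, Matrix.hadamard_apply]

theorem Matrix.PosSemidef.one_sub_of_isIdempotentElem {n : Type} [Fintype n] [DecidableEq n]
    {P : Matrix n n ℂ} (hP : P.IsHermitian) (h : IsIdempotentElem P) : (1 - P).PosSemidef := by
  have h1 : (1 - P)ᴴ = 1 - P := by rw [Matrix.conjTranspose_sub, Matrix.conjTranspose_one, hP]
  have h2 : (1 - P)ᴴ * (1 - P) = 1 - P := by rw [h1]; exact h.one_sub
  exact h2 ▸ Matrix.posSemidef_conjTranspose_mul_self (1 - P)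

/-! ### Prepare-and-measure supermaps -/

/-- The functional `Φ ↦ tr (E Φ(ρ))`: the probability of the effect `E` on the image of `ρ`. -/
def effectProb {n m : Type} [Fintype m] (E : Matrix m m ℂ) (ρ : Matrix n n ℂ) :
    SuperOp n m →ₗ[ℂ] ℂ where
  toFun Φ := (E * Φ ρ).trace
  map_add' Φ Ψ := by rw [LinearMap.add_apply, Matrix.mul_add, Matrix.trace_add]
  map_smul' c Φ := by
    rw [LinearMap.smul_apply, Matrix.mul_smul, Matrix.trace_smul, RingHom.id_apply]

/-- This is, up to index conventions, the Choi matrix of the map left on the ancillas once `ρ` is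
fed in and `E` is measured. -/
theorem posSemidef_effectProb_block {n m : Type} [Fintype n] [Fintype m] {A B : ℕ}
    {E : Matrix m m ℂ} {ρ : Matrix n n ℂ} (hE : E.PosSemidef) (hρ : ρ.PosSemidef)
    {Φ : SuperOp (Fin A × n) (Fin B × m)} (hΦ : IsCP Φ) :
    (Matrix.of fun p q : Fin A × Fin B =>
      effectProb E ρ (block Φ p.1 q.1 p.2 q.2)).PosSemidef := by
  -- `δ` encodes the unnormalised maximally entangled vector of the ancilla and its copy, constant
  -- along `n`.
  let δ : (Fin A × n) × Fin A → ℂ := fun i => if i.1.1 = i.2 then 1 else 0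
  have hZ : (Matrix.vecMulVec δ (star δ) ⊙
      ρ.submatrix (fun i => i.1.2) (fun i => i.1.2)).PosSemidef :=
    (Matrix.posSemidef_vecMulVec_self_star δ).hadamard_complex (hρ.submatrix _)
  -- `tr (E Y)` is the sum of all entries of `Eᵀ ⊙ Y`, hence the transpose.
  have hY := ((hE.transpose.submatrix (fun i : m × (Fin A × Fin B) => i.1)).hadamard
    ((hΦ A _ hZ).submatrix
      (fun i : m × (Fin A × Fin B) => ((i.2.2, i.1), i.2.1)))).sum_blocks
  convert hY using 1
  ext p q
  have hX : (Matrix.vecMulVec δ (star δ) ⊙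
      ρ.submatrix (fun i : (Fin A × n) × Fin A => i.1.2) (fun i => i.1.2)).submatrix
        (fun i => (i, p.1)) (fun i => (i, q.1)) = Matrix.single p.1 q.1 (1 : ℂ) ⊗ₖ ρ := by
    ext i j
    simp only [δ, Matrix.submatrix_apply, Matrix.hadamard_apply, Matrix.vecMulVec_apply,
      Pi.star_apply, Matrix.kroneckerMap_apply, Matrix.single_apply]
    by_cases h1 : i.1 = p.1 <;> by_cases h2 : j.1 = q.1 <;>
      simp [h1, h2, eq_comm (a := p.1), eq_comm (a := q.1)]
  simp only [Matrix.of_apply, Matrix.hadamard_apply, Matrix.submatrix_apply, ampliation, hX,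
    effectProb, block, LinearMap.coe_mk, AddHom.coe_mk, Matrix.trace, Matrix.diag,
    Matrix.mul_apply, Matrix.transpose_apply]
  exact Finset.sum_comm

/-- The map `(Φ_k)_k ↦ ∏ k, tr (E_k Φ_k(ρ_k)) |y⟩⟨y|`. -/
def productEffect {T : ℕ} {n m F : Type} [Fintype m] [DecidableEq F]
    (E : Fin T → Matrix m m ℂ) (ρ : Fin T → Matrix n n ℂ) (y : F) :
    MultilinearMap ℂ (fun _ : Fin T => SuperOp n m) (SuperOp Unit F) :=
  (MultilinearMap.mkPiRing ℂ (Fin T)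
    ((Matrix.entryLinearMap ℂ ℂ () ()).smulRight (Matrix.single y y (1 : ℂ)))).compLinearMap
      fun k => effectProb (E k) (ρ k)

theorem productEffect_apply {T : ℕ} {n m F : Type} [Fintype m] [DecidableEq F]
    (E : Fin T → Matrix m m ℂ) (ρ : Fin T → Matrix n n ℂ) (y : F)
    (M : Fin T → SuperOp n m) (X : Matrix Unit Unit ℂ) :
    productEffect E ρ y M X =
      ((∏ k, effectProb (E k) (ρ k) (M k)) * X () ()) • Matrix.single y y (1 : ℂ) := by
  simp [productEffect, MultilinearMap.mkPiRing_apply]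

/-- The output is a Schur product of the slots' Choi kernels, the input and `|y⟩⟨y|`, summed over
the ancilla inputs. -/
theorem isCP_extend_productEffect {T : ℕ} {n m F : Type} [Fintype n] [Fintype m] [Fintype F]
    [DecidableEq F] {E : Fin T → Matrix m m ℂ} {ρ : Fin T → Matrix n n ℂ}
    (hE : ∀ k, (E k).PosSemidef) (hρ : ∀ k, (ρ k).PosSemidef) (y : F) {A B : Fin T → ℕ}
    {M : ∀ k, SuperOp (Fin (A k) × n) (Fin (B k) × m)} (hM : ∀ k, IsCP (M k)) :
    IsCP (extend (productEffect E ρ y) M) := by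
  intro d X hX
  have hK := Matrix.PosSemidef.prod_hadamard Finset.univ fun k =>
    (posSemidef_effectProb_block (hE k) (hρ k) (hM k)).submatrix
      fun i : (∀ k, Fin (A k)) × (((∀ k, Fin (B k)) × F) × Fin d) => (i.1 k, i.2.1.1 k)
  have hy : (Matrix.single y y (1 : ℂ)).PosSemidef := by
    convert Matrix.posSemidef_vecMulVec_self_star (Pi.single y (1 : ℂ)) using 1
    ext i j
    by_cases h1 : y = i <;> by_cases h2 : y = j <;>
      simp [Matrix.vecMulVec_apply, Matrix.single_apply, Pi.single_apply, h1, h2, eq_comm]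
  convert ((hK.hadamard_complex (hX.submatrix fun i => ((i.1, ()), i.2.2))).hadamard
    (hy.submatrix fun i => i.2.1.2)).sum_blocks using 1
  ext p q
  simp [ampliation, extend, productEffect_apply, Matrix.hadamard_apply]

theorem isCP_extend_sum {T : ℕ} {n m F ι : Type} [Fintype n] [Fintype m] [Fintype F]
    (s : Finset ι) {S : ι → MultilinearMap ℂ (fun _ : Fin T => SuperOp n m) (SuperOp Unit F)}
    {A B : Fin T → ℕ} {M : ∀ k, SuperOp (Fin (A k) × n) (Fin (B k) × m)}
    (h : ∀ i, IsCP (extend (S i) M)) : IsCP (extend (∑ i ∈ s, S i) M) := by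
  intro d X hX
  convert Matrix.posSemidef_sum s fun i _ => h i d X hX using 1
  ext p q
  simp only [ampliation, extend, LinearMap.coe_mk, AddHom.coe_mk, Matrix.of_apply,
    sum_apply, LinearMap.sum_apply, Matrix.sum_apply]
  rw [Finset.sum_comm]
  conv_rhs => rw [Finset.sum_comm]
  rw [Finset.sum_comm]
  refine Finset.sum_congr rfl fun a _ => ?_
  rw [Finset.sum_comm]

/-! ### Unitary channels -/

theorem isChannel_conjMap {n : Type} [Fintype n] [DecidableEq n] {U : Matrix n n ℂ}
    (hU : Uᴴ * U = 1) : IsChannel (conjMap U) := by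
  refine ⟨fun d X hX => ?_, fun X => ?_⟩
  · convert hX.mul_mul_conjTranspose_same (U ⊗ₖ (1 : Matrix (Fin d) (Fin d) ℂ)) using 1
    ext p q
    simp [ampliation, conjMap, Matrix.mul_apply, Fintype.sum_prod_type, Matrix.one_apply,
      Matrix.conjTranspose_apply, apply_ite (starRingEnd ℂ)]
  · simp only [conjMap, LinearMap.coe_mk, AddHom.coe_mk]
    rw [Matrix.trace_mul_comm, ← Matrix.mul_assoc, hU, Matrix.one_mul]

theorem oracle_conjTranspose {n : ℕ} (x : Fin n → Bool) : (oracle x)ᴴ = oracle x := by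
  rw [oracle, Matrix.diagonal_conjTranspose]
  congr 1
  ext i
  refine Fin.cases ?_ (fun i => ?_) i
  · simp
  · by_cases h : x i <;> simp [h]

theorem isChannel_oracle {n : ℕ} (x : Fin n → Bool) : IsChannel (conjMap (oracle x)) := by
  apply isChannel_conjMap
  rw [oracle_conjTranspose, oracle, Matrix.diagonal_mul_diagonal, ← Matrix.diagonal_one]
  congr 1
  ext i
  refine Fin.cases ?_ (fun i => ?_) i
  · simp
  · by_cases h : x i <;> simp [h]

/-! ### The polynomial method for supermaps -/

/-- The map `X ↦ X i j |i⟩⟨j|`. -/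
def entryMap {n : Type} [DecidableEq n] (i j : n) : SuperOp n n :=
  (Matrix.entryLinearMap ℂ ℂ i j).smulRight (Matrix.single i j (1 : ℂ))

/-- All dependence on `x` sits in scalars that are products of two phases. -/
theorem conjMap_oracle_eq_sum {n : ℕ} (x : Fin n → Bool) :
    conjMap (oracle x) = ∑ r : Fin (n + 1) × Fin (n + 1),
      (oracle x r.1 r.1 * oracle x r.2 r.2) • entryMap r.1 r.2 := by
  refine LinearMap.ext fun X => ?_
  have h : conjMap (oracle x) X = oracle x * X * oracle x := by
    simp only [conjMap, LinearMap.coe_mk, AddHom.coe_mk, oracle_conjTranspose]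
  ext i j
  rw [h]
  simp only [LinearMap.sum_apply, Matrix.sum_apply, LinearMap.smul_apply, Matrix.smul_apply,
    entryMap, LinearMap.smulRight_apply, Matrix.entryLinearMap_apply, Matrix.single_apply,
    Fintype.sum_prod_type, smul_eq_mul, oracle, Matrix.diagonal_apply_eq, Matrix.mul_diagonal,
    Matrix.diagonal_mul]
  rw [Finset.sum_eq_single i (fun b _ hb => Finset.sum_eq_zero fun c _ => by simp [hb])
    (by simp), Finset.sum_eq_single j (fun b _ hb => by simp [hb]) (by simp)]
  simp only [and_self, if_true]
  ring

/-- The parity character `(-1)^{|x|}`. -/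
def paritySign {n : ℕ} (x : Fin n → Bool) : ℤ := ∏ i, if x i then -1 else 1

theorem paritySign_update_not {n : ℕ} (x : Fin n → Bool) (m : Fin n) :
    paritySign (Function.update x m (!x m)) = -paritySign x := by
  unfold paritySign
  rw [← Finset.mul_prod_erase _ _ (Finset.mem_univ m),
    ← Finset.mul_prod_erase _ (fun i => if x i then (-1 : ℤ) else 1) (Finset.mem_univ m),
    ← neg_mul]
  congr 1
  · by_cases h : x m <;> simp [h]
  · refine Finset.prod_congr rfl fun i hi => ?_
    rw [Function.update_of_ne (Finset.ne_of_mem_erase hi)]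

theorem oracle_update_of_ne {n : ℕ} (x : Fin n → Bool) (m : Fin n) (b : Bool) {i : Fin (n + 1)}
    (h : i ≠ m.succ) : oracle (Function.update x m b) i i = oracle x i i := by
  revert h
  refine Fin.cases ?_ (fun i => ?_) i
  · simp [oracle]
  · intro h
    have h' : i ≠ m := fun e => h (congrArg Fin.succ e)
    simp [oracle, Function.update_of_ne h']

theorem exists_succ_notMem_range {n T : ℕ} (hT : 2 * T < n)
    (r : Fin T → Fin (n + 1) × Fin (n + 1)) :
    ∃ m : Fin n, ∀ k, (r k).1 ≠ m.succ ∧ (r k).2 ≠ m.succ := by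
  classical
  let U : Finset (Fin (n + 1)) :=
    Finset.univ.image (fun k => (r k).1) ∪ Finset.univ.image (fun k => (r k).2)
  have hU : U.card ≤ T + T := by
    refine (Finset.card_union_le _ _).trans (Nat.add_le_add ?_ ?_) <;>
      exact Finset.card_image_le.trans (by simp)
  by_contra! hc
  have hsub : Finset.univ.image (Fin.succ : Fin n → Fin (n + 1)) ⊆ U := by
    intro i hi
    obtain ⟨m, -, rfl⟩ := Finset.mem_image.1 hi
    obtain ⟨k, hk⟩ := hc m
    by_cases h : (r k).1 = m.succ
    · exact Finset.mem_union_left _ (Finset.mem_image.2 ⟨k, Finset.mem_univ k, h⟩)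
    · exact Finset.mem_union_right _ (Finset.mem_image.2 ⟨k, Finset.mem_univ k, hk h⟩)
  have := Finset.card_le_card hsub
  rw [Finset.card_image_of_injective _ (Fin.succ_injective n), Finset.card_univ,
    Fintype.card_fin] at this
  omega

/-- The `2T` indices miss some bit; flipping it negates the parity and fixes the product, so terms
cancel in pairs. -/
theorem sum_paritySign_mul_eq_zero {n T : ℕ} (hT : 2 * T < n)
    (r : Fin T → Fin (n + 1) × Fin (n + 1)) :
    ∑ x : Fin n → Bool, (paritySign x : ℂ) *
      ∏ k, (oracle x (r k).1 (r k).1 * oracle x (r k).2 (r k).2) = 0 := by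
  obtain ⟨m, hm⟩ := exists_succ_notMem_range hT r
  refine Finset.sum_involution (fun x _ => Function.update x m (!x m)) ?_ ?_ (by simp) (by simp)
  · intro x _
    simp only [paritySign_update_not, oracle_update_of_ne x m _ (hm _).1,
      oracle_update_of_ne x m _ (hm _).2]
    push_cast
    ring
  · intro x _ _ h
    have := congrFun h m
    simp at this

/-- The output of a map with `T < n / 2` slots on copies of the oracle has degree less than `n`. -/
theorem sum_paritySign_smul_eq_zero {n T : ℕ} (hT : 2 * T < n) {V : Type*} [AddCommGroup V]
    [Module ℂ V]
    (S : MultilinearMap ℂ (fun _ : Fin T => SuperOp (Fin (n + 1)) (Fin (n + 1))) V) :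
    ∑ x : Fin n → Bool, (paritySign x : ℂ) • S (fun _ => conjMap (oracle x)) = 0 := by
  classical
  have h : ∀ x : Fin n → Bool, S (fun _ => conjMap (oracle x)) =
      ∑ r : Fin T → Fin (n + 1) × Fin (n + 1),
        (∏ k, (oracle x (r k).1 (r k).1 * oracle x (r k).2 (r k).2)) •
          S fun k => entryMap (r k).1 (r k).2 := by
    intro x
    simp only [conjMap_oracle_eq_sum x, MultilinearMap.map_sum, MultilinearMap.map_smul_univ]
  simp only [h, Finset.smul_sum, smul_smul]
  rw [Finset.sum_comm]
  refine Finset.sum_eq_zero fun r _ => ?_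
  rw [← Finset.sum_smul, sum_paritySign_mul_eq_zero hT r, zero_smul]

theorem le_two_mul_of_computesExactly {n T : ℕ} {f : (Fin n → Bool) → Bool}
    (hf : ∑ x, paritySign x * (if f x then 1 else 0) ≠ 0)
    {S : MultilinearMap ℂ (fun _ : Fin T => SuperOp (Fin (n + 1)) (Fin (n + 1)))
      (SuperOp Unit Bool)} (hS : IsQuantumSupermap S) (hc : ComputesExactly f S) :
    n ≤ 2 * T := by
  by_contra! hT
  apply hf
  have hp : ∀ x, S (fun _ => conjMap (oracle x)) (1 : Matrix Unit Unit ℂ) true true =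
      if f x then 1 else 0 := by
    intro x
    have h1 := hc x
    -- Unit trace turns certainty of the outcome `false` into probability 0 for `true`.
    have h2 := hS.tp_preserving (fun _ => conjMap (oracle x)) (fun _ => isChannel_oracle x) 1
    simp only [Matrix.trace, Matrix.diag, Fintype.sum_bool] at h2
    cases h : f x with
    | true => rw [h] at h1; simpa using h1
    | false => rw [h] at h1; rw [h1] at h2; simpa using h2
  have h0 := congrArg (fun Φ : SuperOp Unit Bool => Φ (1 : Matrix Unit Unit ℂ) true true)
    (sum_paritySign_smul_eq_zero hT S)
  simp only [LinearMap.sum_apply, Matrix.sum_apply, LinearMap.smul_apply, Matrix.smul_apply, hp,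
    LinearMap.zero_apply, Matrix.zero_apply, smul_eq_mul] at h0
  exact_mod_cast h0

theorem sum_paritySign_mul_f6q_ne_zero :
    ∑ x, paritySign x * (if f6q x then 1 else 0) ≠ 0 := by
  decide +kernel

/-! ### Parity queries -/

/-- The projector on `(|p⟩ + |q⟩) / √2`, for `p ≠ q`. -/
noncomputable def probe {n : Type} [DecidableEq n] (p q : n) : Matrix n n ℂ :=
  (1 / 2 : ℂ) • Matrix.vecMulVec (Pi.single p 1 + Pi.single q 1)
    (star (Pi.single p 1 + Pi.single q 1))

theorem posSemidef_probe {n : Type} [DecidableEq n] [Finite n] (p q : n) :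
    (probe p q).PosSemidef :=
  (Matrix.posSemidef_vecMulVec_self_star _).smul (by simp)

theorem trace_probe {n : Type} [DecidableEq n] [Fintype n] {p q : n} (h : p ≠ q) :
    (probe p q).trace = 1 := by
  rw [probe, Matrix.trace_smul, Matrix.trace_vecMulVec]
  simp [h, h.symm]
  norm_num

theorem isIdempotentElem_probe {n : Type} [DecidableEq n] [Fintype n] {p q : n} (h : p ≠ q) :
    IsIdempotentElem (probe p q) := by
  rw [IsIdempotentElem, probe, Matrix.smul_mul, Matrix.mul_smul, Matrix.vecMulVec_mul_vecMulVec]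
  rw [smul_smul, Matrix.vecMulVec_smul, smul_smul]
  congr 1
  simp [h, h.symm]
  norm_num

/-- The measurement of whether the state `probe p q` is left unchanged (outcome `false`). -/
noncomputable def probeEffect {n : Type} [DecidableEq n] (p q : n) (b : Bool) : Matrix n n ℂ :=
  if b then 1 - probe p q else probe p q

theorem posSemidef_probeEffect {n : Type} [DecidableEq n] [Fintype n] {p q : n} (h : p ≠ q)
    (b : Bool) : (probeEffect p q b).PosSemidef := by
  cases b
  · simpa [probeEffect] using posSemidef_probe p q
  · simpa [probeEffect] using Matrix.PosSemidef.one_sub_of_isIdempotentElem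
      (posSemidef_probe p q).isHermitian (isIdempotentElem_probe h)

theorem effectProb_probeEffect_add {n : Type} [DecidableEq n] [Fintype n] {p q : n} (h : p ≠ q)
    {Φ : SuperOp n n} (hΦ : IsTP Φ) :
    effectProb (probeEffect p q false) (probe p q) Φ +
      effectProb (probeEffect p q true) (probe p q) Φ = 1 := by
  simp [effectProb, probeEffect, Matrix.sub_mul, Matrix.trace_sub, hΦ (probe p q), trace_probe h]

/-- The oracle fixes `|p⟩ + |q⟩` up to sign if the two phases agree and otherwise sends it to the
orthogonal `±(|p⟩ - |q⟩)`. -/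
theorem effectProb_oracle {n : ℕ} {p q : Fin (n + 1)} (h : p ≠ q) (x : Fin n → Bool) (b : Bool) :
    effectProb (probeEffect p q b) (probe p q) (conjMap (oracle x)) =
      if b = decide (oracle x p p ≠ oracle x q q) then 1 else 0 := by
  have hd : ∀ i, oracle x i i = 1 ∨ oracle x i i = -1 := by
    refine Fin.cases (by simp [oracle]) fun i => ?_
    by_cases hi : x i <;> simp [oracle, hi]
  have h0 : effectProb (probeEffect p q false) (probe p q) (conjMap (oracle x)) =
      (oracle x p p + oracle x q q) ^ 2 / 4 := by
    have e1 : conjMap (oracle x) (probe p q) = oracle x * probe p q * oracle x := by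
      simp only [conjMap, LinearMap.coe_mk, AddHom.coe_mk, oracle_conjTranspose]
    simp only [effectProb, probeEffect, LinearMap.coe_mk, AddHom.coe_mk, e1]
    simp only [oracle, probe, Matrix.trace, Matrix.diag, Matrix.mul_apply,
      Matrix.diagonal_apply_eq]
    simp [h, h.symm, Matrix.vecMulVec_apply, Pi.single_apply, add_mul, mul_add, Finset.sum_add_distrib]
    ring
  have h1 := effectProb_probeEffect_add h (isChannel_oracle x).2
  rw [h0] at h1
  cases b
  · rw [h0]
    rcases hd p with hp | hp <;> rcases hd q with hq | hq <;> rw [hp, hq] <;> norm_num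
  · rw [eq_sub_of_add_eq' h1]
    rcases hd p with hp | hp <;> rcases hd q with hq | hq <;> rw [hp, hq] <;> norm_num

/-! ### The supermap built on the Lugano process -/

/-- The process function without a global causal order: party `k` receives `a_{k-1} (1 ⊕ a_{k+1})`
(indices modulo 3) when the parties send the bits `a`. -/
def luganoInput (a : Fin 3 → Bool) (k : Fin 3) : Bool := a (k + 2) && !a (k + 1)

/-- The final output on the bits sent by the parties. -/
def luganoOutput (a : Fin 3 → Bool) : Bool :=
  (a 0 && luganoInput a 0) ^^ (a 1 && luganoInput a 1) ^^ (a 2 && luganoInput a 2) ^^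
    (a 0 && a 1 && a 2)

/-- Logical consistency of the process: deterministic local strategies have exactly one fixed point,
and the identity extends multi-affinely to all normalised `p`. -/
theorem sum_luganoInput_eq_one {p : Fin 3 → Bool → Bool → ℂ}
    (hp : ∀ k i, p k i false + p k i true = 1) :
    ∑ a : Fin 3 → Bool, ∏ k, p k (luganoInput a k) (a k) = 1 := by
  have hu : (Finset.univ : Finset (Fin 3 → Bool)) =
      {![false, false, false], ![false, false, true], ![false, true, false], ![false, true, true],
        ![true, false, false], ![true, false, true], ![true, true, false], ![true, true, true]} := by
    decide
  have hp' : ∀ k i, p k i true = 1 - p k i false := fun k i => eq_sub_of_add_eq' (hp k i)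
  rw [hu]
  repeat rw [Finset.sum_insert (by decide)]
  rw [Finset.sum_singleton]
  simp [Fin.prod_univ_three, luganoInput, hp', show (2 : Fin 3) + 2 = 1 from rfl,
    show (1 : Fin 3) + 2 = 0 from rfl, show (1 : Fin 3) + 1 = 2 from rfl,
    show (2 : Fin 3) + 1 = 0 from rfl]
  ring

/-- The index that slot `k` compares with `k + 4`, when it receives the bit `i`. -/
def queryIndex (k : Fin 3) (i : Bool) : Fin (6 + 1) :=
  if i then 0 else (Fin.castAdd 3 k).succ

/-- The second index that slot `k` queries. -/
def queryIndex' (k : Fin 3) : Fin (6 + 1) := (Fin.natAdd 3 k).succ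

theorem queryIndex_ne (k : Fin 3) (i : Bool) : queryIndex k i ≠ queryIndex' k := by
  revert k i; decide

/-- Slot `k`, on receiving the bit `i` from the Lugano process, sends back the bit `x_{k+4}`
if `i = 1` and `x_{k+1} ⊕ x_{k+4}` if `i = 0`. -/
noncomputable def luganoSupermap :
    MultilinearMap ℂ (fun _ : Fin 3 => SuperOp (Fin (6 + 1)) (Fin (6 + 1))) (SuperOp Unit Bool) :=
  ∑ a : Fin 3 → Bool, productEffect
    (fun k => probeEffect (queryIndex k (luganoInput a k)) (queryIndex' k) (a k))
    (fun k => probe (queryIndex k (luganoInput a k)) (queryIndex' k)) (luganoOutput a)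

theorem luganoSupermap_apply (M : Fin 3 → SuperOp (Fin (6 + 1)) (Fin (6 + 1)))
    (X : Matrix Unit Unit ℂ) (b b' : Bool) :
    luganoSupermap M X b b' = ∑ a : Fin 3 → Bool,
      (∏ k, effectProb (probeEffect (queryIndex k (luganoInput a k)) (queryIndex' k) (a k))
        (probe (queryIndex k (luganoInput a k)) (queryIndex' k)) (M k)) * X () () *
        Matrix.single (luganoOutput a) (luganoOutput a) (1 : ℂ) b b' := by
  simp only [luganoSupermap, sum_apply, LinearMap.sum_apply, Matrix.sum_apply,
    productEffect_apply, Matrix.smul_apply, smul_eq_mul]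

theorem isQuantumSupermap_luganoSupermap : IsQuantumSupermap luganoSupermap where
  completely_cp_preserving A B M hM :=
    isCP_extend_sum _ fun a => isCP_extend_productEffect
      (fun k => posSemidef_probeEffect (queryIndex_ne k _) _) (fun k => posSemidef_probe _ _) _ hM
  tp_preserving M hM X := by
    have h := sum_luganoInput_eq_one (p := fun k i b =>
      effectProb (probeEffect (queryIndex k i) (queryIndex' k) b)
        (probe (queryIndex k i) (queryIndex' k)) (M k))
      fun k i => effectProb_probeEffect_add (queryIndex_ne k i) (hM k).2
    simp only [Matrix.trace, Matrix.diag, luganoSupermap_apply]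
    rw [Finset.sum_comm]
    simp only [← Finset.mul_sum, Matrix.single_apply, and_self, Finset.sum_ite_eq,
      Finset.mem_univ, if_true, mul_one]
    rw [← Finset.sum_mul, h]
    simp

theorem exists_luganoInput_fixedPoint (x : Fin 6 → Bool) :
    ∃ a : Fin 3 → Bool, (∀ a' : Fin 3 → Bool, (∀ k, a' k = ((!luganoInput a' k &&
      x (Fin.castAdd 3 k)) ^^ x (Fin.natAdd 3 k))) ↔ a' = a) ∧ luganoOutput a = f6q x := by
  revert x; decide +kernel

/-- Index 0 always has phase 1, so comparison with it reads a single bit. -/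
theorem oracle_queryIndex_ne (x : Fin 6 → Bool) (k : Fin 3) (i : Bool) :
    decide (oracle x (queryIndex k i) (queryIndex k i) ≠
      oracle x (queryIndex' k) (queryIndex' k)) =
        ((!i && x (Fin.castAdd 3 k)) ^^ x (Fin.natAdd 3 k)) := by
  have hs : ∀ j, oracle x (Fin.succ j) (Fin.succ j) = if x j then -1 else 1 := by
    simp [oracle]
  have h0 : oracle x 0 0 = 1 := by simp [oracle]
  have h1 : (-1 : ℂ) ≠ 1 := by norm_num
  cases i <;> simp only [queryIndex, queryIndex', hs, h0, if_true, Bool.false_eq_true, if_false]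
  · cases x (Fin.castAdd 3 k) <;> cases x (Fin.natAdd 3 k) <;> simp [h1, h1.symm]
  · cases x (Fin.natAdd 3 k) <;> simp [h1.symm]

theorem computesExactly_luganoSupermap : ComputesExactly f6q luganoSupermap := by
  intro x
  obtain ⟨a, ha, hf⟩ := exists_luganoInput_fixedPoint x
  -- The product of the three outcome indicators is the indicator of the fixed point `a`.
  simp only [luganoSupermap_apply, effectProb_oracle (queryIndex_ne _ _), oracle_queryIndex_ne,
    Finset.prod_ite_zero, Finset.mem_univ, true_imp_iff, ha]
  rw [Finset.sum_eq_single a (fun b _ hb => by simp [hb]) (by simp)]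
  simp [hf]

/-- The generalised exact quantum query complexity of the 6-bit function `f6q` is 3. -/
theorem mainTheorem4 : QEGen f6q = 3 := by
  have h3 : 3 ∈ {T : ℕ | ∃ S : MultilinearMap ℂ
      (fun _ : Fin T => SuperOp (Fin (6 + 1)) (Fin (6 + 1))) (SuperOp Unit Bool),
      IsQuantumSupermap S ∧ ComputesExactly f6q S} :=
    ⟨luganoSupermap, isQuantumSupermap_luganoSupermap, computesExactly_luganoSupermap⟩
  refine le_antisymm (Nat.sInf_le h3) (le_csInf ⟨3, h3⟩ ?_)
  rintro T ⟨S, hS, hc⟩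
  have := le_two_mul_of_computesExactly sum_paritySign_mul_f6q_ne_zero hS hc
  omega
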